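/- Consider the Nakamoto longest-chain protocol with $n$ nodes, all honest, in synchronous rounds $1,2,\dots$. Initially every node holds the chain that consists of the genesis block only. At the beginning of each round, every node has received all chains broadcast in earlier rounds, and it replaces its local chain by one of the longest chains seen so far, chosen uniformly at random, independently of the other nodes and of the past choices. During the round each node mines one block with probability $p\in(0,1]$, independently of everything else; a node that mines a block appends it to its local chain and broadcasts the resulting chain. The length of a chain is its number of blocks, the genesis block included. Let $L_t$ be the length of the longest common prefix of the $n$ local chains at the end of round $t$. Suppose that $np=\Omega(1)$. Then, in expectation, the local chains at the end of round $t$ share a common prefix of length $1+(1-(1-p)^n)t$ minus an error of order $\frac{1}{np\,e^{-np}}$ if $p<\frac{4\ln 2}{n}$, and of order $\frac{2np}{1-2\exp(-np/3)}$ if $p\ge\frac{4\ln 2}{n}$. Precisely: for every $c>0$ there is a constant $C>0$, depending only on $c$, such that for all integers $n\ge 1$, all $p\in(0,1]$ with $np\ge c$, and all integers $t\ge 0$: 1. if $p<\frac{4\ln 2}{n}$, then $$0\le \bigl(1+(1-(1-p)^n)\,t\bigr)-\mathbb{E}[L_t]\le C\cdot\frac{1}{np\,e^{-np}};$$ 2.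 if $p\ge\frac{4\ln 2}{n}$, then $$0\le \bigl(1+(1-(1-p)^n)\,t\bigr)-\mathbb{E}[L_t]\le C\cdot\frac{2np}{1-2\exp\left(-\frac13 np\right)}.$$ -/

import Mathlib

open scoped NNReal ENNReal

noncomputable section

namespace Nakamoto

/-- A block is the genesis block or the block that `miner` finds in round `round`. A node finds at
most one block per round, so the pair determines the block. -/
inductive Block (n : ℕ) where
  | genesis : Block n
  | mined (miner : Fin n) (round : ℕ) : Block n
  deriving DecidableEq

/-- A chain is the list of its blocks, oldest block first; its length is the number of its blocks,
the genesis block included. -/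
abbrev Chain (n : ℕ) := List (Block n)

/-- The global state at the end of a round. Every broadcast is delivered to every node at the
beginning of the next round, so that all nodes then work with the same set `seen`, which consists
of the genesis chain and of all chains that were broadcast so far. -/
structure State (n : ℕ) where
  seen : Finset (Chain n)
  seen_nonempty : seen.Nonempty
  /-- the local chain of each node -/
  localChain : Fin n → Chain n

/-- The state before the first round: every node holds the chain with just the genesis block. -/
def State.init (n : ℕ) : State n where
  seen := {[Block.genesis]}
  seen_nonempty := Finset.singleton_nonempty _
  localChain := fun _ => [Block.genesis]

/-- The longest chains among the chains that have been seen. -/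
def State.longest {n : ℕ} (s : State n) : Finset (Chain n) :=
  s.seen.filter fun c => ∀ d ∈ s.seen, d.length ≤ c.length

theorem State.longest_nonempty {n : ℕ} (s : State n) : s.longest.Nonempty := by
  obtain ⟨c, hc, h⟩ := s.seen.exists_max_image List.length s.seen_nonempty
  exact ⟨c, Finset.mem_filter.2 ⟨hc, h⟩⟩

/-- Chain choice at the beginning of a round: each node chooses one of the longest chains uniformly
at random, independently of the other nodes (the uniform law on a finite product is the product of
the uniform laws). -/
def State.choice {n : ℕ} (s : State n) : PMF (Fin n → Chain n) :=
  PMF.uniformOfFinset (Fintype.piFinset fun _ : Fin n => s.longest)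
    (Fintype.piFinset_nonempty.2 fun _ => s.longest_nonempty)

/-- Mining in one round: each node finds a block with probability `p`, independently of the other
nodes. -/
def mining (n : ℕ) (p : ℝ≥0) (hp : p ≤ 1) : PMF (Fin n → Bool) :=
  PMF.ofFintype (fun m => ∏ i, if m i then (p : ℝ≥0∞) else 1 - (p : ℝ≥0∞)) (by
    have h := Finset.prod_univ_sum (fun _ : Fin n => (Finset.univ : Finset Bool))
      (fun _ b => if b then (p : ℝ≥0∞) else 1 - (p : ℝ≥0∞))
    rw [Fintype.piFinset_univ] at h
    rw [← h]
    refine Finset.prod_eq_one fun i _ => ?_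
    simpa using add_tsub_cancel_of_le (by exact_mod_cast hp : (p : ℝ≥0∞) ≤ 1))

/-- The local chains at the end of round `r`, when node `i` has chosen the chain `d i` at the
beginning of the round and `m i` tells whether node `i` finds a block in this round. -/
def extend {n : ℕ} (r : ℕ) (d : Fin n → Chain n) (m : Fin n → Bool) (i : Fin n) : Chain n :=
  if m i then d i ++ [Block.mined i r] else d i

/-- The state at the end of round `r`: the nodes that have found a block broadcast their chains. -/
def State.next {n : ℕ} (s : State n) (r : ℕ) (d : Fin n → Chain n) (m : Fin n → Bool) :
    State n where
  seen := s.seen ∪ (Finset.univ.filter fun i => m i = true).image (extend r d m)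
  seen_nonempty := s.seen_nonempty.mono Finset.subset_union_left
  localChain := extend r d m

/-- The law of the state at the end of round `t`. The choices and the mining of a round are
independent of each other and of the past, given the state before that round. -/
def law (n : ℕ) (p : ℝ≥0) (hp : p ≤ 1) : ℕ → PMF (State n)
  | 0 => PMF.pure (State.init n)
  | t + 1 => (law n p hp t).bind fun s =>
      s.choice.bind fun d => (mining n p hp).map fun m => s.next (t + 1) d m

/-- The length of the maximal common prefix of the local chains of all nodes. -/
def State.commonPrefixLength {n : ℕ} (s : State n) : ℕ :=
  sSup {k : ℕ | ∃ P : Chain n, P.length = k ∧ ∀ i, P <+: s.localChain i}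

/-- The contribution of the state `s` to the expected length of the maximal common prefix of the
local chains at the end of round `t`. -/
def commonPrefixTerm (n : ℕ) (p : ℝ≥0) (hp : p ≤ 1) (t : ℕ) (s : State n) : ℝ :=
  (law n p hp t s).toReal * (s.commonPrefixLength : ℝ)

/-- The expected length of the maximal common prefix of the local chains at the end of round `t`. -/
def expectedCommonPrefix (n : ℕ) (p : ℝ≥0) (hp : p ≤ 1) (t : ℕ) : ℝ :=
  ∑' s : State n, commonPrefixTerm n p hp t s

end Nakamoto

end

/-! Write `P = 1 - (1 - p) ^ n` for the probability that a round is successful, i.e. that somebody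
mines. The longest chains grow by one block exactly in successful rounds, so their mean length is `1
+ P * t` (`expect_height`). Local chains are seen chains, which gives the lower bound 0. It remains
to bound the mean shortfall of the common prefix below the longest chains, uniformly in `t`.

Trace ancestries backwards. After a successful round the longest chains are exactly those just
broadcast, one per miner, so a node's choice is a uniform pick `u i` of a miner. If all nodes in `A`
pick the same miner, their gap is 0. Otherwise it is at most one more than the gap of the chains
from which the picked miners started, a gap over the set `A.image u` one round earlier
(`State.gap_next_le`). The ancestral lines thus coalesce.

The mean gap over `A` is dominated by the potential `M * (1 - 1 / A.card)` with `M = 4 * n * p / P`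
(`meanGap_le`). Picking among `k` miners raises the mean of `1 / A.card` by at least `1 / (4 * k)`
(`mean_potential_picks_le`), and given success the mean of `1 / k` is at least `P / (n * p)`. Hence
the potential loses at least 1 per successful round on average, which pays for the added block
(`mining_drift_nonpos`).

The total error is at most `1 + 4 * n * p / P`, which is `O(n * p)` when `n * p ≥ c`. Both regimes
of the theorem follow from this single bound. -/

namespace Nakamoto

/-! ### Expectations of extended nonnegative functions under discrete laws. -/

section Expectation

variable {α β : Type*}

/-- The expectation of a nonnegative function under a discrete law. -/
noncomputable def expect (μ : PMF α) (f : α → ℝ≥0∞) : ℝ≥0∞ := ∑' a, μ a * f a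

theorem expect_pure (a : α) (f : α → ℝ≥0∞) : expect (PMF.pure a) f = f a := by
  rw [expect, tsum_eq_single a]
  · simp
  · intro b hb
    simp [hb]

theorem expect_bind (μ : PMF α) (k : α → PMF β) (f : β → ℝ≥0∞) :
    expect (μ.bind k) f = expect μ fun a => expect (k a) f := by
  simp only [expect, PMF.bind_apply, ← ENNReal.tsum_mul_right, ← ENNReal.tsum_mul_left]
  rw [ENNReal.tsum_comm]
  simp only [mul_assoc]

theorem expect_map (μ : PMF α) (g : α → β) (f : β → ℝ≥0∞) :
    expect (μ.map g) f = expect μ fun a => f (g a) := by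
  rw [← PMF.bind_pure_comp, expect_bind]
  simp [expect_pure]

theorem expect_comm (μ : PMF α) (ν : PMF β) (f : α → β → ℝ≥0∞) :
    expect μ (fun a => expect ν (f a)) = expect ν fun b => expect μ fun a => f a b := by
  simp only [expect, ← ENNReal.tsum_mul_left]
  rw [ENNReal.tsum_comm]
  simp only [mul_left_comm]

theorem expect_mono {μ : PMF α} {f g : α → ℝ≥0∞} (h : ∀ a ∈ μ.support, f a ≤ g a) :
    expect μ f ≤ expect μ g := by
  refine ENNReal.tsum_le_tsum fun a => ?_
  by_cases ha : a ∈ μ.support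
  · gcongr
    exact h a ha
  · simp [(PMF.apply_eq_zero_iff μ a).2 ha]

theorem expect_congr {μ : PMF α} {f g : α → ℝ≥0∞} (h : ∀ a ∈ μ.support, f a = g a) :
    expect μ f = expect μ g :=
  le_antisymm (expect_mono fun a ha => (h a ha).le) (expect_mono fun a ha => (h a ha).ge)

theorem expect_add (μ : PMF α) (f g : α → ℝ≥0∞) :
    expect μ (fun a => f a + g a) = expect μ f + expect μ g := by
  simp only [expect, mul_add, ENNReal.tsum_add]

theorem expect_const (μ : PMF α) (x : ℝ≥0∞) : expect μ (fun _ => x) = x := by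
  simp [expect, ENNReal.tsum_mul_right]

theorem expect_uniformOfFinset (s : Finset α) (hs : s.Nonempty) (f : α → ℝ≥0∞) :
    expect (PMF.uniformOfFinset s hs) f = (s.card : ℝ≥0∞)⁻¹ * ∑ a ∈ s, f a := by
  rw [expect, tsum_eq_sum (s := s), Finset.mul_sum]
  · refine Finset.sum_congr rfl fun a ha => ?_
    rw [PMF.uniformOfFinset_apply_of_mem _ ha]
  · intro a ha
    rw [PMF.uniformOfFinset_apply_of_notMem _ ha, zero_mul]

theorem expect_uniformOfFinset_ofReal (s : Finset α) (hs : s.Nonempty) (f : α → ℝ)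
    (hf : ∀ a, 0 ≤ f a) :
    expect (PMF.uniformOfFinset s hs) (fun a => ENNReal.ofReal (f a)) =
      ENNReal.ofReal ((s.card : ℝ)⁻¹ * ∑ a ∈ s, f a) := by
  have h : (0 : ℝ) < s.card := by exact_mod_cast hs.card_pos
  rw [expect_uniformOfFinset, ENNReal.ofReal_mul (by positivity), ENNReal.ofReal_inv_of_pos h,
    ENNReal.ofReal_natCast, ENNReal.ofReal_sum_of_nonneg fun a _ => hf a]

end Expectation

/-! ### Independent uniform picks: how many distinct values occur. -/

section Picks

variable {ι κ : Type*} [Fintype ι] [DecidableEq ι] [DecidableEq κ]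

/-- Coordinates in `A` range over `S.erase j`, all others over `S`; each coordinate in `A` costs a
factor `1 - 1 / S.card`. -/
theorem card_picks_avoiding (S : Finset κ) (A : Finset ι) (j : κ) (hj : j ∈ S) :
    ((((Fintype.piFinset fun _ : ι => S).filter fun u => j ∉ A.image u).card : ℕ) : ℝ) =
      (S.card : ℝ) ^ Fintype.card ι * (1 - 1 / (S.card : ℝ)) ^ A.card := by
  have hS : (0 : ℝ) < S.card := by exact_mod_cast Finset.card_pos.2 ⟨j, hj⟩
  have h : ((Fintype.piFinset fun _ : ι => S).filter fun u => j ∉ A.image u) =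
      Fintype.piFinset fun i => if i ∈ A then S.erase j else S := by
    ext u
    simp only [Finset.mem_filter, Fintype.mem_piFinset, Finset.mem_image, not_exists, not_and]
    constructor
    · rintro ⟨h1, h2⟩ i
      split_ifs with hi
      · exact Finset.mem_erase.2 ⟨h2 i hi, h1 i⟩
      · exact h1 i
    · intro h
      refine ⟨fun i => ?_, fun i hi => ?_⟩
      · have := h i
        split_ifs at this
        · exact Finset.mem_of_mem_erase this
        · exact this
      · have := h i
        rw [if_pos hi] at this
        exact Finset.ne_of_mem_erase this
  rw [h, Fintype.card_piFinset]
  push_cast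
  have h2 : ∀ i, (((if i ∈ A then S.erase j else S).card : ℕ) : ℝ) =
      (S.card : ℝ) * if i ∈ A then 1 - 1 / (S.card : ℝ) else 1 := by
    intro i
    split_ifs
    · rw [Finset.card_erase_of_mem hj, Nat.cast_sub (Finset.card_pos.2 ⟨j, hj⟩)]
      field_simp
      simp
    · simp
  simp only [h2, Finset.prod_mul_distrib, Finset.prod_const, Finset.card_univ,
    Finset.prod_ite_mem, Finset.univ_inter]

/-- The mean number of distinct values of `A.card` independent uniform picks from `S`. -/
theorem sum_card_image_picks (S : Finset κ) (hS : S.Nonempty) (A : Finset ι) :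
    ∑ u ∈ Fintype.piFinset (fun _ : ι => S), ((A.image u).card : ℝ) =
      (S.card : ℝ) ^ Fintype.card ι * ∑ i ∈ Finset.range A.card, (1 - 1 / (S.card : ℝ)) ^ i := by
  have hk : (0 : ℝ) < S.card := by exact_mod_cast hS.card_pos
  have h1 : ∀ u ∈ Fintype.piFinset (fun _ : ι => S),
      ((A.image u).card : ℝ) = ∑ j ∈ S, (1 - if j ∉ A.image u then (1 : ℝ) else 0) := by
    intro u hu
    rw [Fintype.mem_piFinset] at hu
    have hsub : A.image u ⊆ S := by
      intro j hj
      obtain ⟨i, -, rfl⟩ := Finset.mem_image.1 hj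
      exact hu i
    rw [← Finset.inter_eq_right.2 hsub, Finset.card_eq_sum_ones, ← Finset.sum_ite_mem]
    push_cast
    refine Finset.sum_congr rfl fun j hj => ?_
    rw [Finset.inter_eq_right.2 hsub]
    by_cases h : j ∈ A.image u <;> simp only [h, not_true, not_false_iff, if_true, if_false] <;>
      norm_num
  rw [Finset.sum_congr rfl h1, Finset.sum_comm]
  have h2 : ∀ j ∈ S, ∑ u ∈ Fintype.piFinset (fun _ : ι => S),
      (1 - if j ∉ A.image u then (1 : ℝ) else 0) =
        (S.card : ℝ) ^ Fintype.card ι * (1 - (1 - 1 / (S.card : ℝ)) ^ A.card) := by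
    intro j hj
    rw [Finset.sum_sub_distrib, Finset.sum_boole, card_picks_avoiding S A j hj]
    simp
    ring
  rw [Finset.sum_congr rfl h2, Finset.sum_const, nsmul_eq_mul]
  have := geom_sum_mul_neg (1 - 1 / (S.card : ℝ)) A.card
  rw [← this]
  field_simp
  simp

/-- The increments `q ^ i` decrease, so the partial sums are concave in `j` and lie above the chord
from 0 to `a`. -/
theorem concave_geom_sum (q : ℝ) (h0 : 0 ≤ q) (h1 : q ≤ 1) (a j : ℕ) (hj : j ≤ a) :
    (j : ℝ) * ∑ i ∈ Finset.range a, q ^ i ≤ a * ∑ i ∈ Finset.range j, q ^ i := by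
  induction a, hj using Nat.le_induction with
  | base => rfl
  | succ a hja ih =>
    have h : (j : ℝ) * q ^ a ≤ ∑ i ∈ Finset.range j, q ^ i := by
      rw [← nsmul_eq_mul, ← Finset.card_range j, ← Finset.sum_const, Finset.card_range]
      refine Finset.sum_le_sum fun i hi => ?_
      exact pow_le_pow_of_le_one h0 h1 ((Finset.mem_range.1 hi).le.trans hja)
    rw [Finset.sum_range_succ]
    push_cast
    linarith

theorem card_sub_geom_sum_ge (q : ℝ) (h0 : 0 ≤ q) (h1 : q ≤ 1) (a : ℕ) (ha : 2 ≤ a) :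
    (1 - q) * a * (∑ i ∈ Finset.range a, q ^ i) / 4 ≤ a - ∑ i ∈ Finset.range a, q ^ i := by
  set s : ℕ → ℝ := fun j => ∑ i ∈ Finset.range j, q ^ i with hs
  -- The left side is the sum of `1 - q ^ j = (1 - q) * s j` over `j < a`. The chord bound then
  -- gives `(a - 1) / 2 * s a`, and `(a - 1) / 2 ≥ a / 4` because `a ≥ 2`; this is the origin of the
  -- 4.
  have e1 : (a : ℝ) - s a = (1 - q) * ∑ j ∈ Finset.range a, s j := by
    rw [Finset.mul_sum]
    simp only [hs, mul_comm (1 - q), geom_sum_mul_neg]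
    simp
  have e2 : ((a : ℝ) - 1) / 2 * s a ≤ ∑ j ∈ Finset.range a, s j := by
    have hpos : (0 : ℝ) < a := by positivity
    have h := Finset.sum_le_sum fun j (hj : j ∈ Finset.range a) =>
      concave_geom_sum q h0 h1 a j (Finset.mem_range.1 hj).le
    rw [← Finset.sum_mul, ← Finset.mul_sum] at h
    have hg : (∑ j ∈ Finset.range a, (j : ℝ)) * 2 = a * (a - 1) := by
      have := Finset.sum_range_id_mul_two a
      rw [← Nat.cast_pred (by omega : 0 < a), ← Nat.cast_sum]
      exact_mod_cast this
    refine le_of_mul_le_mul_left ?_ hpos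
    calc (a : ℝ) * ((a - 1) / 2 * s a) = (∑ j ∈ Finset.range a, (j : ℝ)) * s a := by
          linear_combination (-(s a) / 2) * hg
      _ ≤ _ := h
  have hs0 : 0 ≤ s a := Finset.sum_nonneg fun i _ => pow_nonneg h0 i
  have ha' : (2 : ℝ) ≤ a := by exact_mod_cast ha
  change (1 - q) * a * s a / 4 ≤ a - s a
  rw [e1]
  calc (1 - q) * a * s a / 4 = (1 - q) * (a / 4 * s a) := by ring
    _ ≤ (1 - q) * ((a - 1) / 2 * s a) :=
      mul_le_mul_of_nonneg_left (mul_le_mul_of_nonneg_right (by linarith) hs0) (by linarith)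
    _ ≤ _ := mul_le_mul_of_nonneg_left e2 (by linarith)

/-- With `q = 1 - 1 / k`, divide `card_sub_geom_sum_ge` by `a` times the sum. The gain `1 / (4 * k)`
does not depend on `a`, so one potential serves sets of every size. -/
theorem inv_geom_sum_ge (k a : ℕ) (hk : 1 ≤ k) (ha : 2 ≤ a) :
    1 / (a : ℝ) + 1 / (4 * k) ≤ 1 / ∑ i ∈ Finset.range a, (1 - 1 / (k : ℝ)) ^ i := by
  have hk' : (1 : ℝ) ≤ k := by exact_mod_cast hk
  have hq0 : 0 ≤ 1 - 1 / (k : ℝ) := by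
    rw [sub_nonneg, div_le_one (by linarith)]
    exact hk'
  have hq1 : 1 - 1 / (k : ℝ) ≤ 1 := by
    have : 0 ≤ 1 / (k : ℝ) := by positivity
    linarith
  have h := card_sub_geom_sum_ge _ hq0 hq1 a ha
  set s := ∑ i ∈ Finset.range a, (1 - 1 / (k : ℝ)) ^ i with hs
  have hs1 : 0 < s := by
    have : (1 - 1 / (k : ℝ)) ^ 0 ≤ s :=
      Finset.single_le_sum (fun i _ => pow_nonneg hq0 i) (Finset.mem_range.2 (by omega))
    rw [pow_zero] at this
    linarith
  have hap : (0 : ℝ) < a := by positivity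
  rw [le_div_iff₀ hs1]
  have e : (1 / (a : ℝ) + 1 / (4 * k)) * s = (s + (1 - (1 - 1 / (k : ℝ))) * a * s / 4) / a := by
    field_simp
    ring
  rw [e, div_le_one hap]
  linarith

/-- The tangent to the convex function `1 / x` at `y`. Taken at a mean value it yields Jensen's
inequality, both for the number of distinct picks and for the number of miners. -/
theorem inv_ge_tangent (x y : ℝ) (hx : 0 < x) (hy : 0 < y) : 2 / y - x / y ^ 2 ≤ 1 / x := by
  have : 1 / x - (2 / y - x / y ^ 2) = (x - y) ^ 2 / (x * y ^ 2) := by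
    field_simp
    ring
  have h : 0 ≤ (x - y) ^ 2 / (x * y ^ 2) := by positivity
  linarith

/-- Among at least two independent uniform picks from `S`, the reciprocal of the number of distinct
values grows in the mean by at least `1 / (4 * S.card)`. -/
theorem mean_potential_picks_le (S : Finset κ) (hS : S.Nonempty) (A : Finset ι) (hA : 2 ≤ A.card) :
    ((Fintype.piFinset fun _ : ι => S).card : ℝ)⁻¹ *
        ∑ u ∈ Fintype.piFinset (fun _ : ι => S), (1 - 1 / ((A.image u).card : ℝ)) ≤
      1 - 1 / (A.card : ℝ) - 1 / (4 * S.card) := by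
  have hk : (0 : ℝ) < S.card := by exact_mod_cast hS.card_pos
  have hN : ((Fintype.piFinset fun _ : ι => S).card : ℝ) = (S.card : ℝ) ^ Fintype.card ι := by
    simp
  have hmain := inv_geom_sum_ge S.card A.card hS.card_pos hA
  have hsum := sum_card_image_picks S hS A
  set y := ∑ i ∈ Finset.range A.card, (1 - 1 / (S.card : ℝ)) ^ i with hy
  set N := (S.card : ℝ) ^ Fintype.card ι with hNdef
  have hNpos : 0 < N := by positivity
  have hy0 : 0 < y := by
    by_contra hcon
    have h1 : 1 / y ≤ 0 := div_nonpos_of_nonneg_of_nonpos zero_le_one (not_lt.1 hcon)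
    have h2 : (0 : ℝ) < 1 / (A.card : ℝ) + 1 / (4 * S.card) := by positivity
    linarith
  -- The tangent is taken at `y`, the mean number of distinct picks.
  have hle : ∑ u ∈ Fintype.piFinset (fun _ : ι => S), (1 - 1 / ((A.image u).card : ℝ)) ≤
      ∑ u ∈ Fintype.piFinset (fun _ : ι => S), (1 - 2 / y + (A.image u).card / y ^ 2) := by
    refine Finset.sum_le_sum fun u _ => ?_
    have hpos : 0 < (A.image u).card :=
      Finset.card_pos.2 ((Finset.card_pos.1 (by omega)).image u)
    have := inv_ge_tangent ((A.image u).card : ℝ) y (by exact_mod_cast hpos) hy0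
    linarith
  rw [Finset.sum_add_distrib, ← Finset.sum_div, hsum, Finset.sum_const, nsmul_eq_mul, hN] at hle
  rw [hN]
  have hval : N⁻¹ * (N * (1 - 2 / y) + N * y / y ^ 2) = 1 - 1 / y := by
    field_simp
    ring
  calc _ ≤ N⁻¹ * (N * (1 - 2 / y) + N * y / y ^ 2) := by gcongr
    _ = 1 - 1 / y := hval
    _ ≤ _ := by linarith

end Picks
end Nakamoto

namespace Nakamoto

/-! ### Deterministic dynamics of heights, longest chains and gaps. -/

section Chains

variable {n : ℕ}

/-- The length of the longest chains that have been seen. -/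
def State.height (s : State n) : ℕ := s.seen.sup List.length

/-- The length of the longest common prefix of the chains `d i` with `i ∈ A`. -/
noncomputable def commonPrefixOn {ι : Type*} (d : ι → Chain n) (A : Finset ι) : ℕ :=
  sSup {k : ℕ | ∃ P : Chain n, P.length = k ∧ ∀ i ∈ A, P <+: d i}

theorem State.commonPrefixLength_eq (s : State n) :
    s.commonPrefixLength = commonPrefixOn s.localChain Finset.univ := by
  simp [State.commonPrefixLength, commonPrefixOn]

theorem bddAbove_commonPrefix {ι : Type*} (d : ι → Chain n) {A : Finset ι} (hA : A.Nonempty) :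
    BddAbove {k : ℕ | ∃ P : Chain n, P.length = k ∧ ∀ i ∈ A, P <+: d i} := by
  obtain ⟨i, hi⟩ := hA
  refine ⟨(d i).length, ?_⟩
  rintro k ⟨P, rfl, h⟩
  exact (h i hi).length_le

theorem le_commonPrefixOn {ι : Type*} {d : ι → Chain n} {A : Finset ι} (hA : A.Nonempty)
    {P : Chain n} (h : ∀ i ∈ A, P <+: d i) : P.length ≤ commonPrefixOn d A :=
  le_csSup (bddAbove_commonPrefix d hA) ⟨P, rfl, h⟩

theorem exists_commonPrefixOn {ι : Type*} (d : ι → Chain n) {A : Finset ι} (hA : A.Nonempty) :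
    ∃ P : Chain n, P.length = commonPrefixOn d A ∧ ∀ i ∈ A, P <+: d i :=
  Nat.sSup_mem (s := {k : ℕ | ∃ P : Chain n, P.length = k ∧ ∀ i ∈ A, P <+: d i})
    ⟨0, [], rfl, fun _ _ => List.nil_prefix⟩ (bddAbove_commonPrefix d hA)

theorem commonPrefixOn_le {ι : Type*} (d : ι → Chain n) {A : Finset ι} {i : ι} (hi : i ∈ A) :
    commonPrefixOn d A ≤ (d i).length := by
  obtain ⟨P, hP, h⟩ := exists_commonPrefixOn d ⟨i, hi⟩
  exact hP ▸ (h i hi).length_le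

theorem State.length_le_height {s : State n} {c : Chain n} (hc : c ∈ s.seen) :
    c.length ≤ s.height :=
  Finset.le_sup (f := List.length) hc

theorem State.mem_longest {s : State n} {c : Chain n} :
    c ∈ s.longest ↔ c ∈ s.seen ∧ c.length = s.height := by
  rw [State.longest, Finset.mem_filter]
  refine and_congr_right fun hc => ⟨fun h => ?_, fun h d hd => ?_⟩
  · exact le_antisymm (State.length_le_height hc) (Finset.sup_le h)
  · exact h ▸ State.length_le_height hd

theorem State.height_init : (State.init n).height = 1 := by
  simp [State.height, State.init]

/-- The chain that node `i` broadcasts when it finds a block in round `r`. -/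
def broadcast (r : ℕ) (d : Fin n → Chain n) (i : Fin n) : Chain n := d i ++ [Block.mined i r]

/-- The last block records its miner. Therefore a uniform choice among the new longest chains is a
uniform choice among the miners. -/
theorem broadcast_injective (r : ℕ) (d : Fin n → Chain n) :
    Function.Injective (broadcast r d) := by
  intro i j h
  have h2 := congrArg List.getLast? h
  simpa [broadcast] using h2

theorem prefix_extend (r : ℕ) (d : Fin n → Chain n) (m : Fin n → Bool) (i : Fin n) :
    d i <+: extend r d m i := by
  unfold extend
  split_ifs
  · exact List.prefix_append _ _
  · exact List.prefix_rfl

/-- The nodes that find a block. -/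
def miners (m : Fin n → Bool) : Finset (Fin n) := Finset.univ.filter fun i => m i = true

theorem State.seen_next (s : State n) (r : ℕ) (d : Fin n → Chain n) (m : Fin n → Bool) :
    (s.next r d m).seen = s.seen ∪ (miners m).image (broadcast r d) := by
  rw [State.next, miners]
  exact congrArg (s.seen ∪ ·) (Finset.image_congr fun i hi => by
    have hi : m i = true := (Finset.mem_filter.1 hi).2
    simp [extend, broadcast, hi])

theorem State.seen_next_of_empty (s : State n) (r : ℕ) (d : Fin n → Chain n) {m : Fin n → Bool}
    (hm : miners m = ∅) : (s.next r d m).seen = s.seen := by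
  simp [State.seen_next, hm]

theorem length_broadcast {s : State n} {d : Fin n → Chain n} (hd : ∀ i, d i ∈ s.longest) (r : ℕ)
    (i : Fin n) : (broadcast r d i).length = s.height + 1 := by
  simp [broadcast, (State.mem_longest.1 (hd i)).2]

theorem State.height_next_of_empty (s : State n) (r : ℕ) (d : Fin n → Chain n) {m : Fin n → Bool}
    (hm : miners m = ∅) : (s.next r d m).height = s.height := by
  rw [State.height, s.seen_next_of_empty r d hm, State.height]

theorem State.height_next {s : State n} {d : Fin n → Chain n} (hd : ∀ i, d i ∈ s.longest) (r : ℕ)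
    {m : Fin n → Bool} (hm : (miners m).Nonempty) : (s.next r d m).height = s.height + 1 := by
  rw [State.height, State.seen_next, Finset.sup_union, Finset.sup_image]
  have h : (miners m).sup (List.length ∘ broadcast r d) = s.height + 1 := by
    have he : List.length ∘ broadcast r d = fun _ => s.height + 1 :=
      funext fun i => length_broadcast hd r i
    rw [he, Finset.sup_const hm]
  rw [h]
  exact max_eq_right (Nat.le_succ _)

/-- Every miner extends a chain of maximal length, so all broadcasts tie at the new height and no
older chain reaches it. -/
theorem State.longest_next {s : State n} {d : Fin n → Chain n} (hd : ∀ i, d i ∈ s.longest) (r : ℕ)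
    {m : Fin n → Bool} (hm : (miners m).Nonempty) :
    (s.next r d m).longest = (miners m).image (broadcast r d) := by
  ext c
  rw [State.mem_longest, State.seen_next, State.height_next hd r hm, Finset.mem_union]
  constructor
  · rintro ⟨h | h, hc⟩
    · have := State.length_le_height h
      omega
    · exact h
  · intro h
    refine ⟨Or.inr h, ?_⟩
    obtain ⟨i, -, rfl⟩ := Finset.mem_image.1 h
    exact length_broadcast hd r i

theorem State.mem_longest_of_mem_support_choice {s : State n} {d : Fin n → Chain n}
    (hd : d ∈ s.choice.support) (i : Fin n) : d i ∈ s.longest := by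
  rw [State.choice, PMF.mem_support_uniformOfFinset_iff, Fintype.mem_piFinset] at hd
  exact hd i

theorem State.choice_congr {s s' : State n} (h : s.longest = s'.longest) : s.choice = s'.choice := by
  simp only [State.choice, h]

/-- How much shorter than the longest chains the common prefix of the chains `d i`, `i ∈ A`, is. -/
noncomputable def State.gap (s : State n) (d : Fin n → Chain n) (A : Finset (Fin n)) : ℕ :=
  s.height - commonPrefixOn d A

/-- One coalescence step. A common pick makes the whole broadcast chain shared; otherwise the common
prefix of the picked miners' parent chains survives while the height rises by one. -/
theorem State.gap_next_le {s : State n} {d : Fin n → Chain n} (hd : ∀ i, d i ∈ s.longest) (r : ℕ)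
    {m : Fin n → Bool} (hm : (miners m).Nonempty) (u : Fin n → Fin n) {A : Finset (Fin n)}
    (hA : A.Nonempty) :
    (s.next r d m).gap (fun i => broadcast r d (u i)) A ≤
      if (A.image u).card = 1 then 0 else 1 + s.gap d (A.image u) := by
  rw [State.gap, State.height_next hd r hm]
  split_ifs with h
  · obtain ⟨j, hj⟩ := Finset.card_eq_one.1 h
    have hle := le_commonPrefixOn (d := fun i => broadcast r d (u i)) hA
      (P := broadcast r d j) fun i hi => by
        have : u i ∈ A.image u := Finset.mem_image_of_mem u hi
        rw [hj, Finset.mem_singleton] at this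
        rw [this]
    rw [length_broadcast hd] at hle
    omega
  · obtain ⟨P, hP, hP2⟩ := exists_commonPrefixOn d (hA.image u)
    have hle := le_commonPrefixOn (d := fun i => broadcast r d (u i)) hA (P := P) fun i hi =>
      (hP2 _ (Finset.mem_image_of_mem u hi)).trans (List.prefix_append _ _)
    rw [State.gap]
    omega

theorem State.gap_eq_zero_of_card_eq_one {s : State n} {d : Fin n → Chain n}
    (hd : ∀ i, d i ∈ s.longest) {A : Finset (Fin n)} (hA : A.card = 1) : s.gap d A = 0 := by
  obtain ⟨j, rfl⟩ := Finset.card_eq_one.1 hA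
  have hle := le_commonPrefixOn (d := d) (Finset.singleton_nonempty j) (P := d j) fun i hi => by
    rw [Finset.mem_singleton.1 hi]
  rw [(State.mem_longest.1 (hd j)).2] at hle
  rw [State.gap]
  omega

theorem State.commonPrefixLength_next_le {s : State n} {d : Fin n → Chain n}
    (hd : ∀ i, d i ∈ s.longest) (r : ℕ) (m : Fin n → Bool) (i : Fin n) :
    (s.next r d m).commonPrefixLength ≤ (s.next r d m).height := by
  rw [State.commonPrefixLength_eq]
  refine (commonPrefixOn_le _ (Finset.mem_univ i)).trans ?_
  apply State.length_le_height
  rw [State.next]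
  by_cases h : m i = true
  · exact Finset.mem_union_right _ (Finset.mem_image_of_mem _ (by simp [h]))
  · refine Finset.mem_union_left _ ?_
    simpa [extend, h] using (State.mem_longest.1 (hd i)).1

/-- Passes from the chains chosen at the start of a round to the local chains at its end: mining
only extends the choices, and the height grows by at most one. -/
theorem State.height_next_le {s : State n} {d : Fin n → Chain n} (hd : ∀ i, d i ∈ s.longest)
    (r : ℕ) (m : Fin n → Bool) (i : Fin n) :
    (s.next r d m).height ≤
      1 + s.gap d Finset.univ + (s.next r d m).commonPrefixLength := by
  have h1 : (s.next r d m).height ≤ s.height + 1 := by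
    rcases (miners m).eq_empty_or_nonempty with hm | hm
    · rw [s.height_next_of_empty r d hm]
      omega
    · rw [State.height_next hd r hm]
  have h2 : commonPrefixOn d Finset.univ ≤ (s.next r d m).commonPrefixLength := by
    rw [State.commonPrefixLength_eq]
    obtain ⟨P, hP, hP2⟩ := exists_commonPrefixOn d ⟨i, Finset.mem_univ i⟩
    rw [← hP]
    exact le_commonPrefixOn ⟨i, Finset.mem_univ i⟩ fun j hj =>
      (hP2 j hj).trans (prefix_extend r d m j)
  rw [State.gap]
  omega

end Chains

/-! ### Moments of the mining law. -/

section Mining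

variable {n : ℕ} {p : ℝ≥0}

theorem toReal_mining (hp : p ≤ 1) (m : Fin n → Bool) :
    (mining n p hp m).toReal = ∏ i, if m i then (p : ℝ) else 1 - (p : ℝ) := by
  rw [mining, PMF.ofFintype_apply, ENNReal.toReal_prod]
  refine Finset.prod_congr rfl fun i _ => ?_
  split_ifs
  · simp
  · rw [ENNReal.toReal_sub_of_le (by exact_mod_cast hp) ENNReal.one_ne_top]
    simp

theorem sum_toReal_mining (hp : p ≤ 1) : ∑ m, (mining n p hp m).toReal = 1 := by
  have h := (mining n p hp).tsum_coe
  rw [tsum_fintype] at h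
  rw [← ENNReal.toReal_sum fun m _ => (mining n p hp).apply_ne_top m, h, ENNReal.toReal_one]

theorem miners_eq_empty_iff (m : Fin n → Bool) : miners m = ∅ ↔ m = fun _ => false := by
  simp [miners, Finset.filter_eq_empty_iff, funext_iff]

/-- The probability that some node finds a block. -/
theorem sum_toReal_mining_nonempty (hp : p ≤ 1) :
    ∑ m, (mining n p hp m).toReal * (if miners m = ∅ then 0 else 1) = 1 - (1 - (p : ℝ)) ^ n := by
  have h : ∀ m, (mining n p hp m).toReal * (if miners m = ∅ then (0 : ℝ) else 1) =
      (mining n p hp m).toReal -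
        if m = (fun _ => false) then (mining n p hp m).toReal else 0 := by
    intro m
    simp only [miners_eq_empty_iff]
    split_ifs <;> simp
  rw [Finset.sum_congr rfl fun m _ => h m, Finset.sum_sub_distrib, sum_toReal_mining,
    Finset.sum_ite_eq' Finset.univ, if_pos (Finset.mem_univ _), toReal_mining]
  simp

/-- The mean number of blocks found in a round. -/
theorem sum_toReal_mining_card (hp : p ≤ 1) :
    ∑ m, (mining n p hp m).toReal * ((miners m).card : ℝ) = n * p := by
  have h : ∀ i : Fin n, ∑ m, (mining n p hp m).toReal * (if m i = true then (1 : ℝ) else 0) = p := by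
    intro i
    have h1 : ∀ m : Fin n → Bool,
        (mining n p hp m).toReal * (if m i = true then (1 : ℝ) else 0) =
          ∏ j, (if m j then (p : ℝ) else if j = i then 0 else 1 - (p : ℝ)) := by
      intro m
      rw [toReal_mining]
      split_ifs with hi
      · rw [mul_one]
        refine Finset.prod_congr rfl fun j _ => ?_
        by_cases hj : j = i
        · subst hj
          simp [hi]
        · simp [hj]
      · rw [mul_zero]
        symm
        exact Finset.prod_eq_zero (Finset.mem_univ i) (by simp [hi])
    have h2 := Finset.prod_univ_sum (fun _ : Fin n => (Finset.univ : Finset Bool))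
      (fun j b => if b then (p : ℝ) else if j = i then 0 else 1 - (p : ℝ))
    rw [Fintype.piFinset_univ] at h2
    rw [Finset.sum_congr rfl fun m _ => h1 m, ← h2, Finset.prod_eq_single i]
    · simp
    · intro j _ hj
      simp [hj]
    · simp
  have hc : ∀ m : Fin n → Bool,
      ((miners m).card : ℝ) = ∑ i, if m i = true then (1 : ℝ) else 0 := by
    intro m
    simp [miners]
  simp only [hc, Finset.mul_sum]
  rw [Finset.sum_comm, Finset.sum_congr rfl fun i _ => h i]
  simp

end Mining
end Nakamoto

namespace Nakamoto

/-! ### Recursion for the mean gap and its potential bound. -/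

section Coalescence

variable {n : ℕ} {p : ℝ≥0}

theorem minerPicks_nonempty {m : Fin n → Bool} (hm : (miners m).Nonempty) :
    (Fintype.piFinset fun _ : Fin n => miners m).Nonempty :=
  Fintype.piFinset_nonempty.2 fun _ => hm

/-- After a successful round, choosing a longest chain amounts to choosing a miner of that round. -/
theorem expect_choice_next {s : State n} {d : Fin n → Chain n} (hd : ∀ i, d i ∈ s.longest) (r : ℕ)
    {m : Fin n → Bool} (hm : (miners m).Nonempty) (f : (Fin n → Chain n) → ℝ≥0∞) :
    expect (s.next r d m).choice f =
      expect (PMF.uniformOfFinset _ (minerPicks_nonempty hm)) fun u =>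
        f fun i => broadcast r d (u i) := by
  have hinj : Function.Injective fun (u : Fin n → Fin n) i => broadcast r d (u i) :=
    (broadcast_injective r d).comp_left
  have himg : (Fintype.piFinset fun _ : Fin n => (s.next r d m).longest) =
      (Fintype.piFinset fun _ : Fin n => miners m).image fun u i => broadcast r d (u i) := by
    rw [State.longest_next hd r hm]
    exact Fintype.piFinset_image _ _
  rw [State.choice, expect_uniformOfFinset, expect_uniformOfFinset, himg,
    Finset.card_image_of_injective _ hinj, Finset.sum_image fun x _ y _ h => hinj h]

theorem expect_mining_ofReal (hp : p ≤ 1) (f : (Fin n → Bool) → ℝ) (hf : ∀ m, 0 ≤ f m) :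
    expect (mining n p hp) (fun m => ENNReal.ofReal (f m)) =
      ENNReal.ofReal (∑ m, (mining n p hp m).toReal * f m) := by
  rw [expect, tsum_fintype, ENNReal.ofReal_sum_of_nonneg fun m _ =>
    mul_nonneg ENNReal.toReal_nonneg (hf m)]
  refine Finset.sum_congr rfl fun m _ => ?_
  rw [ENNReal.ofReal_mul ENNReal.toReal_nonneg, ENNReal.ofReal_toReal ((mining n p hp).apply_ne_top m)]

theorem expect_law_succ (hp : p ≤ 1) (t : ℕ) (f : State n → ℝ≥0∞) :
    expect (law n p hp (t + 1)) f = expect (law n p hp t) fun s => expect s.choice fun d =>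
      expect (mining n p hp) fun m => f (s.next (t + 1) d m) := by
  rw [law, expect_bind]
  simp only [expect_bind, expect_map]

/-- The mean length by which the common prefix of the chains that the nodes in `A` choose at the
beginning of round `t + 1` falls short of the length of the longest chains. -/
noncomputable def meanGap (hp : p ≤ 1) (t : ℕ) (A : Finset (Fin n)) : ℝ≥0∞ :=
  expect (law n p hp t) fun s => expect s.choice fun d => (s.gap d A : ℝ≥0∞)

theorem meanGap_eq_zero_of_card_eq_one (hp : p ≤ 1) (t : ℕ) {A : Finset (Fin n)} (hA : A.card = 1) :
    meanGap hp t A = 0 := by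
  have h : meanGap hp t A = expect (law n p hp t) fun s => expect s.choice fun _ => 0 :=
    expect_congr fun s _ => expect_congr fun d hd => by
      rw [State.gap_eq_zero_of_card_eq_one (State.mem_longest_of_mem_support_choice hd) hA,
        Nat.cast_zero]
  rw [h]
  simp only [expect_const]

/-- The mean gap of the picks after a round in which `m` says which nodes find a block. -/
noncomputable def meanGapAfter (hp : p ≤ 1) (t : ℕ) (A : Finset (Fin n)) (m : Fin n → Bool) :
    ℝ≥0∞ :=
  if hm : (miners m).Nonempty then
    expect (PMF.uniformOfFinset _ (minerPicks_nonempty hm)) fun u =>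
      if (A.image u).card = 1 then 0 else 1 + meanGap hp t (A.image u)
  else meanGap hp t A

theorem expect_gap_next_le (hp : p ≤ 1) (t : ℕ) {A : Finset (Fin n)} (hA : A.Nonempty)
    (m : Fin n → Bool) :
    (expect (law n p hp t) fun s => expect s.choice fun d =>
      expect (s.next (t + 1) d m).choice fun d' => ((s.next (t + 1) d m).gap d' A : ℝ≥0∞)) ≤
      meanGapAfter hp t A m := by
  rw [meanGapAfter]
  split_ifs with hm
  · set μ := PMF.uniformOfFinset _ (minerPicks_nonempty hm)
    calc _ ≤ expect (law n p hp t) fun s => expect s.choice fun d => expect μ fun u =>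
          if (A.image u).card = 1 then 0 else 1 + (s.gap d (A.image u) : ℝ≥0∞) := by
          refine expect_mono fun s _ => expect_mono fun d hd => ?_
          have hd := State.mem_longest_of_mem_support_choice hd
          rw [expect_choice_next hd _ hm]
          refine expect_mono fun u _ => ?_
          have h := State.gap_next_le hd (t + 1) hm u hA
          split_ifs at h ⊢
          · simpa using h
          · exact_mod_cast h
      -- For fixed `m` the law of the picks `u` depends on neither `s` nor `d`. With `u` outermost,
      -- the inner mean is `meanGap` of the fixed set `A.image u`.
      _ = expect μ fun u => expect (law n p hp t) fun s => expect s.choice fun d =>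
          if (A.image u).card = 1 then 0 else 1 + (s.gap d (A.image u) : ℝ≥0∞) := by
          simp_rw [expect_comm _ μ]
      _ = _ := by
          refine expect_congr fun u _ => ?_
          split_ifs
          · simp only [expect_const]
          · simp only [expect_add, expect_const, meanGap]
  · rw [Finset.not_nonempty_iff_eq_empty] at hm
    refine expect_mono fun s _ => ?_
    refine (expect_mono (g := fun _ => expect s.choice fun d => (s.gap d A : ℝ≥0∞))
      fun d _ => ?_).trans (expect_const _ _).le
    -- With no new block the longest chains are unchanged, so the fresh choice has the same law as
    -- the previous one.
    have hl : (s.next (t + 1) d m).longest = s.longest := by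
      ext c
      rw [State.mem_longest, State.mem_longest, s.seen_next_of_empty _ d hm,
        s.height_next_of_empty _ d hm]
    rw [State.choice_congr hl]
    simp only [State.gap, s.height_next_of_empty _ d hm]
    rfl

theorem meanGap_succ_le (hp : p ≤ 1) (t : ℕ) {A : Finset (Fin n)} (hA : A.Nonempty) :
    meanGap hp (t + 1) A ≤ expect (mining n p hp) (meanGapAfter hp t A) := by
  rw [meanGap, expect_law_succ]
  simp_rw [expect_comm _ (mining n p hp)]
  exact expect_mono fun m _ => expect_gap_next_le hp t hA m

theorem one_sub_one_div_card_nonneg {α : Type*} (A : Finset α) : 0 ≤ 1 - 1 / (A.card : ℝ) := by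
  rcases Nat.eq_zero_or_pos A.card with h | h
  · simp [h]
  · rw [sub_nonneg, div_le_one (by exact_mod_cast h)]
    exact_mod_cast h

theorem meanGapAfter_le (hp : p ≤ 1) (t : ℕ) {M : ℝ} (hM : 0 ≤ M)
    (ih : ∀ A : Finset (Fin n), A.Nonempty →
      meanGap hp t A ≤ ENNReal.ofReal (M * (1 - 1 / (A.card : ℝ))))
    {A : Finset (Fin n)} (hA : 2 ≤ A.card) {m : Fin n → Bool} (hm : (miners m).Nonempty) :
    meanGapAfter hp t A m ≤
      ENNReal.ofReal (1 + M * (1 - 1 / (A.card : ℝ) - 1 / (4 * (miners m).card))) := by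
  have hAne : A.Nonempty := Finset.card_pos.1 (by omega)
  have hnn : ∀ u : Fin n → Fin n, 0 ≤ 1 + M * (1 - 1 / ((A.image u).card : ℝ)) := fun u =>
    add_nonneg zero_le_one (mul_nonneg hM (one_sub_one_div_card_nonneg _))
  rw [meanGapAfter, dif_pos hm]
  calc _ ≤ expect (PMF.uniformOfFinset _ (minerPicks_nonempty hm)) fun u =>
        ENNReal.ofReal (1 + M * (1 - 1 / ((A.image u).card : ℝ))) := by
        refine expect_mono fun u _ => ?_
        split_ifs
        · exact zero_le
        · rw [ENNReal.ofReal_add zero_le_one (mul_nonneg hM (one_sub_one_div_card_nonneg _)),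
            ENNReal.ofReal_one]
          gcongr
          exact ih _ (hAne.image u)
    _ = _ := expect_uniformOfFinset_ofReal _ _ _ hnn
    _ ≤ _ := by
        refine ENNReal.ofReal_le_ofReal ?_
        have h := mul_le_mul_of_nonneg_left (mean_potential_picks_le (miners m) hm A hA) hM
        have hc : (0 : ℝ) < (Fintype.piFinset fun _ : Fin n => miners m).card := by
          exact_mod_cast (minerPicks_nonempty hm).card_pos
        rw [Finset.sum_add_distrib, ← Finset.mul_sum, mul_add, Finset.sum_const, nsmul_eq_mul,
          mul_one, inv_mul_cancel₀ hc.ne']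
        linarith

/-- The mean drift of the coalescence potential is nonpositive. -/
theorem mining_drift_nonpos (hp : p ≤ 1) (hnp : 0 < (n : ℝ) * p)
    (hP : 0 < 1 - (1 - (p : ℝ)) ^ n) :
    ∑ m, (mining n p hp m).toReal * (if miners m = ∅ then 0 else
      1 - 4 * (n * p) / (1 - (1 - (p : ℝ)) ^ n) * (1 / (4 * (miners m).card))) ≤ 0 := by
  set P := 1 - (1 - (p : ℝ)) ^ n with hPdef
  have h : ∀ m : Fin n → Bool, (if miners m = ∅ then 0 else
      1 - 4 * (n * p) / P * (1 / (4 * ((miners m).card : ℝ)))) ≤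
      -(if miners m = ∅ then 0 else 1) + P / (n * p) * ((miners m).card : ℝ) := by
    intro m
    split_ifs with hm
    · simp [hm]
    · have hk : (0 : ℝ) < (miners m).card := by
        exact_mod_cast (Finset.nonempty_iff_ne_empty.2 hm).card_pos
      -- `n * p / P` is the mean number of miners given that there is one, so the tangent bound
      -- becomes an equality in the mean.
      have h1 := inv_ge_tangent _ (n * p / P) hk (div_pos hnp hP)
      have h2 := mul_le_mul_of_nonneg_left h1 (div_pos hnp hP).le
      have e1 : n * p / P * (2 / (n * p / P) - (miners m).card / (n * p / P) ^ 2) =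
          2 - P / (n * p) * ((miners m).card : ℝ) := by
        generalize ((miners m).card : ℝ) = k at *
        generalize (n : ℝ) * p = x at *
        field_simp
      have e2 : 4 * (n * p) / P * (1 / (4 * ((miners m).card : ℝ))) =
          n * p / P * (1 / ((miners m).card : ℝ)) := by
        field_simp
      linarith
  calc _ ≤ ∑ m, (mining n p hp m).toReal * (-(if miners m = ∅ then 0 else 1) +
        P / (n * p) * ((miners m).card : ℝ)) :=
        Finset.sum_le_sum fun m _ => mul_le_mul_of_nonneg_left (h m) ENNReal.toReal_nonneg
    _ = -(∑ m, (mining n p hp m).toReal * (if miners m = ∅ then 0 else 1)) +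
        P / (n * p) * ∑ m, (mining n p hp m).toReal * ((miners m).card : ℝ) := by
        rw [Finset.mul_sum, ← Finset.sum_neg_distrib, ← Finset.sum_add_distrib]
        exact Finset.sum_congr rfl fun m _ => by ring
    _ = 0 := by
        rw [sum_toReal_mining_nonempty, sum_toReal_mining_card, div_mul_cancel₀ _ hnp.ne']
        ring
    _ ≤ 0 := le_rfl

theorem meanGap_le (hp : p ≤ 1) (hnp : 0 < (n : ℝ) * p) (hP : 0 < 1 - (1 - (p : ℝ)) ^ n) (t : ℕ) :
    ∀ A : Finset (Fin n), A.Nonempty → meanGap hp t A ≤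
      ENNReal.ofReal (4 * (n * p) / (1 - (1 - (p : ℝ)) ^ n) * (1 - 1 / (A.card : ℝ))) := by
  have hM : 0 ≤ 4 * (n * p) / (1 - (1 - (p : ℝ)) ^ n) := by positivity
  have hdrift := mining_drift_nonpos hp hnp hP
  set M := 4 * (n * p) / (1 - (1 - (p : ℝ)) ^ n) with hMdef
  induction t with
  | zero =>
    intro A hA
    have h0 : meanGap hp 0 A = 0 := by
      rw [meanGap, law, expect_pure]
      refine (expect_congr (g := fun _ => 0) fun d hd => ?_).trans (expect_const _ _)
      have hd := State.mem_longest_of_mem_support_choice hd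
      have hd' : ∀ i, d i = [Block.genesis] := fun i => by
        simpa [State.init] using (State.mem_longest.1 (hd i)).1
      have h1 := le_commonPrefixOn (d := d) hA (P := [Block.genesis]) fun i _ => by rw [hd' i]
      rw [State.gap, State.height_init, Nat.sub_eq_zero_of_le (by simpa using h1), Nat.cast_zero]
    rw [h0]
    exact zero_le
  | succ t ih =>
    intro A hA
    -- Singletons are handled apart: the gain of `1 / (4 * k)` requires at least two picks.
    rcases (Nat.succ_le_of_lt hA.card_pos).eq_or_lt with h1 | h2
    · rw [meanGap_eq_zero_of_card_eq_one hp _ h1.symm]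
      exact zero_le
    set x := 1 - 1 / (A.card : ℝ) with hx
    have hx0 : 0 ≤ x := one_sub_one_div_card_nonneg A
    set f : (Fin n → Bool) → ℝ := fun m => M * x +
      (if miners m = ∅ then 0 else 1 - M * (1 / (4 * ((miners m).card : ℝ)))) with hf
    -- `ENNReal.ofReal` truncates at 0, so the drift may be averaged over the reals only once `f` is
    -- nonnegative. In a successful round `f m - 1` is `M` times an upper bound for a mean of
    -- nonnegative terms.
    have hf0 : ∀ m, 0 ≤ f m := by
      intro m
      simp only [hf]
      split_ifs with hm
      · positivity
      · have hmean := mean_potential_picks_le (miners m) (Finset.nonempty_iff_ne_empty.2 hm) A h2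
        have h3 : 0 ≤ x - 1 / (4 * ((miners m).card : ℝ)) :=
          (mul_nonneg (by positivity) (Finset.sum_nonneg fun u _ =>
            one_sub_one_div_card_nonneg _)).trans hmean
        linarith [mul_nonneg hM h3]
    calc _ ≤ expect (mining n p hp) (meanGapAfter hp t A) := meanGap_succ_le hp t hA
      _ ≤ expect (mining n p hp) fun m => ENNReal.ofReal (max (f m) 0) := by
          refine expect_mono fun m _ => ?_
          refine le_trans ?_ (ENNReal.ofReal_le_ofReal (le_max_left _ _))
          rcases (miners m).eq_empty_or_nonempty with hm | hm
          · simpa [meanGapAfter, hm, hf, hx] using ih A hA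
          · refine (meanGapAfter_le hp t hM ih h2 hm).trans (le_of_eq ?_)
            simp only [hf, if_neg hm.ne_empty]
            congr 1
            ring
      _ = ENNReal.ofReal (∑ m, (mining n p hp m).toReal * f m) := by
          rw [expect_mining_ofReal hp _ fun m => le_max_right _ _]
          congr 1
          refine Finset.sum_congr rfl fun m _ => ?_
          rw [max_eq_left]
          exact hf0 m
      _ ≤ _ := by
          refine ENNReal.ofReal_le_ofReal ?_
          simp only [hf, mul_add, Finset.sum_add_distrib, ← Finset.sum_mul, sum_toReal_mining]
          linarith

end Coalescence
end Nakamoto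

namespace Nakamoto

/-! ### Mean height, and the two-sided bound for the mean common prefix. -/

section Expectations

variable {n : ℕ} {p : ℝ≥0}

/-- The mean length of the longest chains at the end of round `t`. -/
theorem expect_height (hp : p ≤ 1) (t : ℕ) :
    expect (law n p hp t) (fun s => (s.height : ℝ≥0∞)) =
      ENNReal.ofReal (1 + (1 - (1 - (p : ℝ)) ^ n) * t) := by
  have hp' : (p : ℝ) ≤ 1 := by exact_mod_cast hp
  have hP : 0 ≤ 1 - (1 - (p : ℝ)) ^ n :=
    sub_nonneg.2 (pow_le_one₀ (sub_nonneg.2 hp') (by linarith [p.coe_nonneg]))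
  induction t with
  | zero => simp [law, expect_pure, State.height_init]
  | succ t ih =>
    have hstep : ∀ s : State n, (expect s.choice fun d => expect (mining n p hp) fun m =>
        ((s.next (t + 1) d m).height : ℝ≥0∞)) =
        s.height + ENNReal.ofReal (1 - (1 - (p : ℝ)) ^ n) := by
      intro s
      rw [← sum_toReal_mining_nonempty hp, ← expect_mining_ofReal hp _ fun m => by
        split_ifs <;> norm_num]
      refine (expect_congr (g := fun _ => _) fun d hd => ?_).trans (expect_const _ _)
      have hd := State.mem_longest_of_mem_support_choice hd
      rw [← expect_const (mining n p hp) (s.height : ℝ≥0∞), ← expect_add]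
      refine expect_congr fun m _ => ?_
      split_ifs with hm
      · simp [s.height_next_of_empty _ d hm]
      · simp [State.height_next hd _ (Finset.nonempty_iff_ne_empty.2 hm)]
    rw [expect_law_succ]
    simp only [hstep]
    rw [expect_add, ih, expect_const, ← ENNReal.ofReal_add (by positivity) hP]
    congr 1
    push_cast
    ring

theorem expect_commonPrefixLength_le (hp : p ≤ 1) (hn : 0 < n) (t : ℕ) :
    expect (law n p hp t) (fun s => (s.commonPrefixLength : ℝ≥0∞)) ≤
      expect (law n p hp t) fun s => (s.height : ℝ≥0∞) := by
  cases t with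
  | zero =>
    rw [law, expect_pure, expect_pure, State.commonPrefixLength_eq, State.height_init]
    exact_mod_cast commonPrefixOn_le _ (Finset.mem_univ (⟨0, hn⟩ : Fin n))
  | succ t =>
    rw [expect_law_succ, expect_law_succ]
    refine expect_mono fun s _ => expect_mono fun d hd => expect_mono fun m _ => ?_
    exact_mod_cast State.commonPrefixLength_next_le
      (State.mem_longest_of_mem_support_choice hd) (t + 1) m ⟨0, hn⟩

theorem expect_height_le (hp : p ≤ 1) (hn : 0 < n) (hnp : 0 < (n : ℝ) * p)
    (hP : 0 < 1 - (1 - (p : ℝ)) ^ n) (t : ℕ) :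
    expect (law n p hp t) (fun s => (s.height : ℝ≥0∞)) ≤
      ENNReal.ofReal (1 + 4 * (n * p) / (1 - (1 - (p : ℝ)) ^ n)) +
        expect (law n p hp t) fun s => (s.commonPrefixLength : ℝ≥0∞) := by
  have huniv : (Finset.univ : Finset (Fin n)).Nonempty := ⟨⟨0, hn⟩, Finset.mem_univ _⟩
  cases t with
  | zero =>
    refine le_add_left ?_
    rw [law, expect_pure, expect_pure, State.commonPrefixLength_eq, State.height_init]
    exact_mod_cast le_commonPrefixOn (d := (State.init n).localChain) huniv
      (P := [Block.genesis]) fun i _ => List.prefix_rfl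
  | succ t =>
    calc _ ≤ expect (law n p hp t) fun s => expect s.choice fun d =>
          expect (mining n p hp) fun m => (1 : ℝ≥0∞) + (s.gap d Finset.univ : ℝ≥0∞) +
            ((s.next (t + 1) d m).commonPrefixLength : ℝ≥0∞) := by
          rw [expect_law_succ]
          refine expect_mono fun s _ => expect_mono fun d hd => expect_mono fun m _ => ?_
          exact_mod_cast State.height_next_le
            (State.mem_longest_of_mem_support_choice hd) (t + 1) m ⟨0, hn⟩
      _ = 1 + meanGap hp t (Finset.univ : Finset (Fin n)) +
          expect (law n p hp (t + 1)) fun s => (s.commonPrefixLength : ℝ≥0∞) := by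
          simp only [expect_add, expect_const, expect_law_succ, meanGap]
      _ ≤ _ := by
          have hM : 0 ≤ 4 * (n * p) / (1 - (1 - (p : ℝ)) ^ n) := by positivity
          rw [ENNReal.ofReal_add zero_le_one hM, ENNReal.ofReal_one]
          gcongr
          refine (meanGap_le hp hnp hP t _ huniv).trans (ENNReal.ofReal_le_ofReal ?_)
          refine mul_le_of_le_one_right hM ?_
          have : 0 ≤ 1 / ((Finset.univ : Finset (Fin n)).card : ℝ) := by positivity
          linarith

theorem toReal_expect_commonPrefixLength (hp : p ≤ 1) (t : ℕ) :
    (expect (law n p hp t) fun s => (s.commonPrefixLength : ℝ≥0∞)).toReal =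
      expectedCommonPrefix n p hp t := by
  rw [expect, ENNReal.tsum_toReal_eq fun s =>
    ENNReal.mul_ne_top ((law n p hp t).apply_ne_top s) (ENNReal.natCast_ne_top _)]
  simp [expectedCommonPrefix, commonPrefixTerm]

theorem summable_commonPrefixTerm (hp : p ≤ 1) (hn : 0 < n) (t : ℕ) :
    Summable (commonPrefixTerm n p hp t) := by
  have h : (expect (law n p hp t) fun s => (s.commonPrefixLength : ℝ≥0∞)) ≠ ⊤ :=
    ne_top_of_le_ne_top (expect_height (n := n) hp t ▸ ENNReal.ofReal_ne_top)
      (expect_commonPrefixLength_le hp hn t)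
  refine (ENNReal.summable_toReal h).congr fun s => ?_
  simp [commonPrefixTerm]

theorem expected_gap_bounds (hp : p ≤ 1) (hn : 0 < n) (hnp : 0 < (n : ℝ) * p)
    (hP : 0 < 1 - (1 - (p : ℝ)) ^ n) (t : ℕ) :
    0 ≤ (1 + (1 - (1 - (p : ℝ)) ^ n) * (t : ℝ)) - expectedCommonPrefix n p hp t ∧
      (1 + (1 - (1 - (p : ℝ)) ^ n) * (t : ℝ)) - expectedCommonPrefix n p hp t ≤
        1 + 4 * (n * p) / (1 - (1 - (p : ℝ)) ^ n) := by
  have h0 : 0 ≤ 1 + (1 - (1 - (p : ℝ)) ^ n) * (t : ℝ) := by positivity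
  have h1 : 0 ≤ 1 + 4 * (n * p) / (1 - (1 - (p : ℝ)) ^ n) := by positivity
  have hle := expect_commonPrefixLength_le hp hn t
  have hge := expect_height_le hp hn hnp hP t
  rw [expect_height] at hle hge
  rw [← toReal_expect_commonPrefixLength]
  have hfin := ne_top_of_le_ne_top ENNReal.ofReal_ne_top hle
  constructor
  · exact sub_nonneg.2 (ENNReal.toReal_le_of_le_ofReal h0 hle)
  · rw [← ENNReal.ofReal_toReal hfin, ← ENNReal.ofReal_add h1 ENNReal.toReal_nonneg,
      ENNReal.ofReal_le_ofReal_iff (add_nonneg h1 ENNReal.toReal_nonneg)] at hge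
    linarith

theorem one_sub_exp_neg_le (hp : p ≤ 1) {c : ℝ} (h : c ≤ (n : ℝ) * p) :
    1 - Real.exp (-c) ≤ 1 - (1 - (p : ℝ)) ^ n := by
  have hp' : (p : ℝ) ≤ 1 := by exact_mod_cast hp
  have h1 : (1 - (p : ℝ)) ^ n ≤ Real.exp (-(p : ℝ)) ^ n :=
    pow_le_pow_left₀ (sub_nonneg.2 hp') (Real.one_sub_le_exp_neg _) n
  rw [← Real.exp_nat_mul] at h1
  have h2 : Real.exp (n * -(p : ℝ)) ≤ Real.exp (-c) := Real.exp_le_exp.2 (by linarith)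
  linarith

end Expectations

end Nakamoto

/-! ### Choice of the constant and the two regimes of `p`. -/

theorem mainTheorem2 (c : ℝ) (hc : 0 < c) :
    ∃ C : ℝ, 0 < C ∧ ∀ (n : ℕ) (p : ℝ≥0) (hp : p ≤ 1), c ≤ (n : ℝ) * (p : ℝ) → ∀ t : ℕ,
      Summable (Nakamoto.commonPrefixTerm n p hp t) ∧
      ((p : ℝ) < 4 * Real.log 2 / (n : ℝ) →
        0 ≤ (1 + (1 - (1 - (p : ℝ)) ^ n) * (t : ℝ)) - Nakamoto.expectedCommonPrefix n p hp t ∧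
        (1 + (1 - (1 - (p : ℝ)) ^ n) * (t : ℝ)) - Nakamoto.expectedCommonPrefix n p hp t ≤
          C * (1 / ((n : ℝ) * (p : ℝ) * Real.exp (-((n : ℝ) * (p : ℝ)))))) ∧
      (4 * Real.log 2 / (n : ℝ) ≤ (p : ℝ) →
        0 ≤ (1 + (1 - (1 - (p : ℝ)) ^ n) * (t : ℝ)) - Nakamoto.expectedCommonPrefix n p hp t ∧
        (1 + (1 - (1 - (p : ℝ)) ^ n) * (t : ℝ)) - Nakamoto.expectedCommonPrefix n p hp t ≤
          C * (2 * (n : ℝ) * (p : ℝ) /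
            (1 - 2 * Real.exp (-(1 / 3) * ((n : ℝ) * (p : ℝ)))))) := by
  have hlog := Real.log_two_gt_d9
  have hlog' := Real.log_two_lt_d9
  set q := 1 - Real.exp (-c) with hq
  have hq0 : 0 < q := sub_pos.2 (Real.exp_lt_one_iff.2 (by linarith))
  -- Since `n * p ≥ c`, the summand 1 is at most `n * p / c`, and `q` bounds `P` from below; so `1 +
  -- 4 * n * p / P ≤ K * (n * p)`.
  set K := 1 / c + 4 / q with hK
  have hK0 : 0 < K := by positivity
  refine ⟨9 * K, by positivity, fun n p hp hcp t => ?_⟩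
  have hnp : 0 < (n : ℝ) * p := hc.trans_le hcp
  have hn : 0 < n := Nat.pos_of_ne_zero fun h => by simp [h] at hnp
  have hn' : (0 : ℝ) < n := by exact_mod_cast hn
  have hqP : q ≤ 1 - (1 - (p : ℝ)) ^ n := Nakamoto.one_sub_exp_neg_le hp hcp
  obtain ⟨hlow, hup⟩ := Nakamoto.expected_gap_bounds hp hn hnp (hq0.trans_le hqP) t
  have hbound : 1 + 4 * (n * p) / (1 - (1 - (p : ℝ)) ^ n) ≤ K * (n * p) := by
    have h1 : 1 ≤ 1 / c * (n * p) := by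
      rw [one_div_mul_eq_div, one_le_div hc]
      exact hcp
    have h2 : 4 * (n * p) / (1 - (1 - (p : ℝ)) ^ n) ≤ 4 * (n * p) / q := by gcongr
    calc _ ≤ 1 / c * (n * p) + 4 * (n * p) / q := add_le_add h1 h2
      _ = _ := by rw [hK]; ring
  refine ⟨Nakamoto.summable_commonPrefixTerm hp hn t, fun hlt => ⟨hlow, ?_⟩,
    fun hge => ⟨hlow, ?_⟩⟩
  · rw [lt_div_iff₀ hn', mul_comm] at hlt
    refine (hup.trans hbound).trans ?_
    generalize (n : ℝ) * p = x at *
    -- `4 * log 2 < 3`; hence `x ^ 2 * exp (-x) ≤ 9`, the source of the factor 9 in the constant.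
    have hx : x < 3 := by linarith
    have hexp : Real.exp (-x) ≤ 1 := Real.exp_le_one_iff.2 (by linarith)
    have h9 : x * (x * Real.exp (-x)) ≤ 9 := by
      calc x * (x * Real.exp (-x)) ≤ 3 * (3 * 1) := by gcongr
        _ = 9 := by norm_num
    rw [mul_one_div, le_div_iff₀ (by positivity), mul_assoc, mul_comm 9 K]
    exact mul_le_mul_of_nonneg_left h9 hK0.le
  · rw [div_le_iff₀ hn', mul_comm (p : ℝ)] at hge
    refine (hup.trans hbound).trans ?_
    rw [mul_assoc 2]
    generalize (n : ℝ) * p = x at *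
    -- Here `x / 3 ≥ 4 / 3 * log 2 > log 2`, so the exponential is below `1 / 2`. The denominator
    -- then lies in `(0, 1]`, and dividing by it only enlarges `2 * x`.
    have hden : 0 < 1 - 2 * Real.exp (-(1 / 3) * x) := by
      have h : Real.exp (-(1 / 3) * x) < Real.exp (-Real.log 2) := Real.exp_lt_exp.2 (by linarith)
      rw [Real.exp_neg, Real.exp_log two_pos] at h
      linarith
    have hden1 : 1 - 2 * Real.exp (-(1 / 3) * x) ≤ 1 := by
      linarith [Real.exp_pos (-(1 / 3) * x)]
    have h2 : 2 * x ≤ 2 * x / (1 - 2 * Real.exp (-(1 / 3) * x)) :=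
      le_div_self (by positivity) hden hden1
    calc K * x ≤ 9 * K * (2 * x) := by linarith [mul_pos hK0 hnp]
      _ ≤ _ := by gcongr
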